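/- **Theorem (Inversion for the Neil algebra $\mathfrak{A}$).** Let $\mathbb{T}=\{e^{it}\}$ be the unit circle with normalized arc length $\frac{dt}{2\pi}$, let $L^p=L^p(\mathbb{T})$ and $\hat f(n)=\int_0^{2\pi} f\,e^{-int}\,\frac{dt}{2\pi}$. For $p=2,\infty$ let $H^p=\{f\in L^p:\hat f(n)=0 \text{ for all } n<0\}$, and identify $f\in H^p$ with the holomorphic function $f(z)=\sum_{n\ge 0}\hat f(n)z^n$ on the open unit disc $\mathbb{D}$. Let $\mathfrak{A}=\{\psi\in H^\infty:\psi'(0)=0\}$. An element $\psi\in\mathfrak{A}$ is invertible in $\mathfrak{A}$ if it does not vanish in $\mathbb{D}$ and $1/\psi\in\mathfrak{A}$. Let $\mathbb{B}^2=\{(a,b)\in\mathbb{C}^2:|a|^2+|b|^2=1\}$. For $\alpha=(a,b)\in\mathbb{B}^2$ let $$H^2_\alpha=\{f\in H^2: f(0)\,b=f'(0)\,a\},$$ let $V_\alpha:H^2_\alpha\to L^2$ be the inclusion, and for $\phi\in L^\infty$ let $T^\alpha_\phi=V_\alpha^*M_\phi V_\alpha:H^2_\alpha\to H^2_\alpha$,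 where $M_\phi f=\phi f$ on $L^2$. Suppose $\phi\in L^\infty$ is unimodular, i.e. $|\phi|=1$ almost everywhere. Then 1. the distance in $L^\infty$ from $\phi$ to $\mathfrak{A}$ is strictly less than one if and only if $T^\alpha_\phi$ is left invertible, as a bounded operator on $H^2_\alpha$, for every $\alpha\in\mathbb{B}^2$; 2. the distance in $L^\infty$ from $\phi$ to the set of invertible elements of $\mathfrak{A}$ is strictly less than one if and only if $T^\alpha_\phi$ is invertible, as a bounded operator on $H^2_\alpha$, for every $\alpha\in\mathbb{B}^2$. -/

import Mathlib

open MeasureTheory AddCircle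
open scoped ENNReal Real

namespace NeilAlgebra

noncomputable section

instance factTwoPiPos : Fact (0 < 2 * π) := ⟨Real.two_pi_pos⟩

/-- The unit circle `𝕋`, parametrised by `t ↦ exp (i t)`, `t ∈ ℝ / 2πℤ`. -/
abbrev Torus : Type := AddCircle (2 * π)

/-- Normalised arc length `dt / 2π` on the circle. -/
abbrev arcLength : Measure Torus := haarAddCircle

/-- The space `L^p(𝕋)` of complex valued functions, with respect to `dt / 2π`. -/
abbrev LpT (p : ℝ≥0∞) : Type := Lp ℂ p arcLength

/-- The Fourier coefficient `∫ f(t) exp(-int) dt/2π` of `f ∈ L^p(𝕋)`. -/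
def coeff {p : ℝ≥0∞} (f : LpT p) (n : ℤ) : ℂ := fourierCoeff (f : Torus → ℂ) n

section FourierFacts

set_option linter.unusedSectionVars false

variable {p : ℝ≥0∞} [hp : Fact (1 ≤ p)]

theorem integrable_coe (f : LpT p) : Integrable (f : Torus → ℂ) arcLength :=
  (Lp.memLp f).integrable hp.out

theorem coeff_add (f g : LpT p) (n : ℤ) : coeff (f + g) n = coeff f n + coeff g n := by
  unfold coeff
  rw [fourierCoeff_congr_ae (Lp.coeFn_add f g),
    fourierCoeff.add (integrable_coe f) (integrable_coe g), Pi.add_apply]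

theorem coeff_smul (c : ℂ) (f : LpT p) (n : ℤ) : coeff (c • f) n = c * coeff f n := by
  unfold coeff
  rw [fourierCoeff_congr_ae (Lp.coeFn_smul c f), fourierCoeff.const_smul, smul_eq_mul]

theorem norm_coeff_le (f : LpT p) (n : ℤ) : ‖coeff f n‖ ≤ ‖f‖ := by
  have h1 : ‖coeff f n‖ ≤ ∫ t, ‖(f : Torus → ℂ) t‖ ∂arcLength := by
    unfold coeff fourierCoeff
    refine (norm_integral_le_integral_norm _).trans (le_of_eq ?_)
    refine integral_congr_ae (Filter.Eventually.of_forall fun t => ?_)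
    simp only [norm_smul, fourier_apply, Circle.norm_coe, one_mul]
  refine h1.trans ?_
  rw [integral_norm_eq_lintegral_enorm (Lp.aestronglyMeasurable f), ← eLpNorm_one_eq_lintegral_enorm,
    Lp.norm_def]
  exact ENNReal.toReal_mono (Lp.eLpNorm_ne_top f)
    (eLpNorm_le_eLpNorm_of_exponent_le hp.out (Lp.aestronglyMeasurable f))

variable (p) in
/-- The `n`-th Fourier coefficient as a bounded linear functional on `L^p(𝕋)`. -/
def coeffL (n : ℤ) : LpT p →L[ℂ] ℂ :=
  LinearMap.mkContinuous
    { toFun := fun f => coeff f n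
      map_add' := fun f g => coeff_add f g n
      map_smul' := fun c f => coeff_smul c f n } 1
    (fun f => by simpa using norm_coeff_le f n)

theorem coeffL_apply (n : ℤ) (f : LpT p) : coeffL p n f = coeff f n := rfl

end FourierFacts

/-- The Hardy space `H^p(𝕋)`: the `f ∈ L^p(𝕋)` whose negative Fourier coefficients vanish. -/
def hardy (p : ℝ≥0∞) [Fact (1 ≤ p)] : Submodule ℂ (LpT p) where
  carrier := {f | ∀ n : ℤ, n < 0 → coeff f n = 0}
  add_mem' := fun {f g} hf hg n hn => by rw [coeff_add, hf n hn, hg n hn, add_zero]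
  zero_mem' := fun n _ => (coeffL p n).map_zero
  smul_mem' := fun c f hf n hn => by rw [coeff_smul, hf n hn, mul_zero]

/-- The holomorphic function `z ↦ ∑ f̂(n) zⁿ` on the unit disc `𝔻` that corresponds to
`f ∈ H^p(𝕋)` under the identification of `H^p(𝔻)` with `H^p(𝕋)`. -/
def discFun {p : ℝ≥0∞} (f : LpT p) (z : ℂ) : ℂ := ∑' n : ℕ, coeff f n * z ^ n

/-- The open unit disc. -/
abbrev disc : Set ℂ := Metric.ball 0 1

section DiscFacts

set_option linter.unusedSectionVars false

variable {p : ℝ≥0∞} [hp : Fact (1 ≤ p)]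

theorem discFun_hasFPowerSeriesOnBall (f : LpT p) :
    HasFPowerSeriesOnBall (discFun f)
      (FormalMultilinearSeries.ofScalars ℂ (fun n : ℕ => coeff f n)) 0 1 := by
  have hr : (1 : ℝ≥0∞) ≤
      (FormalMultilinearSeries.ofScalars ℂ (fun n : ℕ => coeff f n)).radius := by
    have := FormalMultilinearSeries.le_radius_of_bound
      (FormalMultilinearSeries.ofScalars ℂ (fun n : ℕ => coeff f n)) (r := 1) ‖f‖ (fun n => by
        simpa [FormalMultilinearSeries.ofScalars_norm] using norm_coeff_le f n)
    simpa using this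
  have h := (FormalMultilinearSeries.hasFPowerSeriesOnBall
    (FormalMultilinearSeries.ofScalars ℂ (fun n : ℕ => coeff f n))
    (lt_of_lt_of_le one_pos hr)).mono one_pos hr
  refine h.congr fun z _ => ?_
  simp [FormalMultilinearSeries.sum, discFun, mul_comm]

theorem discFun_zero (f : LpT p) : discFun f 0 = coeff f 0 := by
  unfold discFun
  rw [tsum_eq_single 0 (fun n hn => by simp [hn])]
  simp

theorem deriv_discFun_zero (f : LpT p) : deriv (discFun f) 0 = coeff f 1 := by
  rw [(discFun_hasFPowerSeriesOnBall f).hasFPowerSeriesAt.deriv]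
  simp

end DiscFacts

/-- The Neil algebra `𝔄`: the `ψ ∈ H^∞` with `ψ'(0) = 0`. -/
def neil : Submodule ℂ (LpT ∞) where
  carrier := {ψ | ψ ∈ hardy ∞ ∧ deriv (discFun ψ) 0 = 0}
  add_mem' := fun {f g} hf hg => ⟨add_mem hf.1 hg.1, by
    have h1 := hf.2
    have h2 := hg.2
    rw [deriv_discFun_zero] at h1 h2 ⊢
    rw [coeff_add, h1, h2, add_zero]⟩
  zero_mem' := ⟨zero_mem _, by rw [deriv_discFun_zero]; exact (coeffL ∞ 1).map_zero⟩
  smul_mem' := fun c f hf => ⟨Submodule.smul_mem _ c hf.1, by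
    have h1 := hf.2
    rw [deriv_discFun_zero] at h1 ⊢
    rw [coeff_smul, h1, mul_zero]⟩

/-- The invertible elements of `𝔄`: the `ψ ∈ 𝔄` without zeros in the disc whose reciprocal
`1 / ψ` (as a function on the disc) belongs to `𝔄`. -/
def neilInvertible : Set (LpT ∞) :=
  {ψ | ψ ∈ neil ∧ (∀ z ∈ disc, discFun ψ z ≠ 0) ∧
    ∃ η ∈ neil, ∀ z ∈ disc, discFun η z = 1 / discFun ψ z}

theorem coeff_const_one (n : ℤ) :
    coeff (Lp.const ∞ arcLength (1 : ℂ)) n = if n = 0 then 1 else 0 := by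
  have h := fourierCoeff_congr_ae (T := 2 * π) (Lp.coeFn_const (p := ∞) (μ := arcLength) (1 : ℂ))
  unfold coeff
  rw [h]
  have h2 := orthonormal_iff_ite.mp (orthonormal_fourier (T := 2 * π)) n 0
  rw [ContinuousMap.inner_toLp (𝕜 := ℂ) haarAddCircle (fourier n) (fourier 0)] at h2
  rw [← h2]
  unfold fourierCoeff
  refine integral_congr_ae (Filter.Eventually.of_forall fun t => ?_)
  simp

/-- The constant `1` is invertible in `𝔄`; in particular `𝔄` and its set of invertible elements
are nonempty, so that distances to them have their usual meaning. -/
theorem const_one_mem_neilInvertible : Lp.const ∞ arcLength (1 : ℂ) ∈ neilInvertible := by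
  have hmem : Lp.const ∞ arcLength (1 : ℂ) ∈ neil :=
    ⟨fun n hn => by rw [coeff_const_one, if_neg hn.ne], by
      rw [deriv_discFun_zero, coeff_const_one, if_neg one_ne_zero]⟩
  have hone : ∀ z, discFun (Lp.const ∞ arcLength (1 : ℂ)) z = 1 := fun z => by
    unfold discFun
    rw [tsum_eq_single 0 (fun n hn => by
      rw [coeff_const_one, if_neg (by exact_mod_cast hn), zero_mul])]
    simp [coeff_const_one]
  exact ⟨hmem, fun z _ => by simp [hone], _, hmem, fun z _ => by simp [hone]⟩

/-- The parameter set `𝔹² = {(a, b) ∈ ℂ² : |a|² + |b|² = 1}`. -/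
def sphere : Set (ℂ × ℂ) := {α | ‖α.1‖ ^ 2 + ‖α.2‖ ^ 2 = 1}

/-- The space `H²_α = {f ∈ H² : f(0) b = f'(0) a}`, for `α = (a, b)`. -/
def hardyAt (α : ℂ × ℂ) : Submodule ℂ (LpT 2) where
  carrier := {f | f ∈ hardy 2 ∧ discFun f 0 * α.2 = deriv (discFun f) 0 * α.1}
  add_mem' := fun {f g} hf hg => ⟨add_mem hf.1 hg.1, by
    have h1 := hf.2
    have h2 := hg.2
    rw [deriv_discFun_zero, discFun_zero] at h1 h2 ⊢
    rw [coeff_add, coeff_add, add_mul, add_mul, h1, h2]⟩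
  zero_mem' := ⟨zero_mem _, by
    rw [deriv_discFun_zero, discFun_zero, ← coeffL_apply, ← coeffL_apply]; simp⟩
  smul_mem' := fun c f hf => ⟨Submodule.smul_mem _ c hf.1, by
    have h1 := hf.2
    rw [deriv_discFun_zero, discFun_zero] at h1 ⊢
    rw [coeff_smul, coeff_smul, mul_assoc, mul_assoc, h1]⟩

theorem isClosed_hardyAt (α : ℂ × ℂ) : IsClosed (hardyAt α : Set (LpT 2)) := by
  have h : (hardyAt α : Set (LpT 2)) =
      (⋂ n : ℤ, ⋂ _ : n < 0, {f | coeffL 2 n f = 0}) ∩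
        {f | coeffL 2 0 f * α.2 = coeffL 2 1 f * α.1} := by
    ext f
    simp only [Set.mem_inter_iff, Set.mem_iInter, Set.mem_ofPred_eq, coeffL_apply]
    rw [← discFun_zero, ← deriv_discFun_zero]
    rfl
  rw [h]
  refine IsClosed.inter (isClosed_iInter fun n => isClosed_iInter fun _ =>
    isClosed_eq (coeffL 2 n).continuous continuous_const) (isClosed_eq ?_ ?_)
  · exact (coeffL 2 0).continuous.mul continuous_const
  · exact (coeffL 2 1).continuous.mul continuous_const

instance completeSpace_hardyAt (α : ℂ × ℂ) : CompleteSpace (hardyAt α) :=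
  (isClosed_hardyAt α).completeSpace_coe

/-- The multiplication operator `M_φ f = φ f` on `L²(𝕋)`, for `φ ∈ L^∞(𝕋)`. -/
def mulOp (φ : LpT ∞) : LpT 2 →L[ℂ] LpT 2 :=
  (ContinuousLinearMap.mul ℂ ℂ).holderL arcLength ∞ 2 2 φ

theorem mulOp_ae (φ : LpT ∞) (f : LpT 2) :
    (mulOp φ f : Torus → ℂ) =ᵐ[arcLength] fun t => φ t * f t := by
  simpa [mulOp] using (ContinuousLinearMap.mul ℂ ℂ).coeFn_holder (r := 2) φ f

/-- The Toeplitz operator `T^α_φ = V_α^* M_φ V_α` on `H²_α`, where `V_α : H²_α → L²` is the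
inclusion. -/
def toeplitz (α : ℂ × ℂ) (φ : LpT ∞) : hardyAt α →L[ℂ] hardyAt α :=
  (ContinuousLinearMap.adjoint (hardyAt α).subtypeL).comp
    ((mulOp φ).comp (hardyAt α).subtypeL)

end

end NeilAlgebra

namespace NeilAlgebra

noncomputable section

/-! ### Multiplication operators and Fourier coefficients -/

/-! Write P_α for the projection onto H²_α and T_φ for the Toeplitz operator at α. Multiplication by
ψ ∈ 𝔄 preserves every H²_α, so T_φ^* T_ψ = V_α^* M_φ^* M_ψ V_α. Since φ is unimodular, this differs
from the identity by V_α^* M_φ^* M_{φ-ψ} V_α, of norm at most ‖φ - ψ‖. When that is below one, T_φ^*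
T_ψ is invertible (`isUnit_adjoint_toeplitz_mul_toeplitz`), and its adjoint yields a left inverse of
T_φ. If moreover 1/ψ ∈ 𝔄, then T_ψ is invertible, hence so is T_φ.

Conversely, left invertibility bounds T_φ below, so by Pythagoras the Hankel operator (1 - P_α) M_φ
P_α has norm below one. The parameter sphere is compact and P_α is norm continuous in α, so one r <
1 serves all α (`exists_hankel_bound`). A factorization then turns this into |∫ φ z̄ h| ≤ r ‖h‖₁ for
h in the disc algebra with h'(0) = 0: write h = c q with |q|² ≈ |h| and q zero-free, and let the
1-jet of q at 0 select α. Then q ∈ H²_α, and z c̄ ⊥ H²_α precisely because (cq)'(0) = 0. Hahn–Banach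
and the duality of L¹ and L^∞ produce χ with ‖χ‖ ≤ r and φ - χ ∈ 𝔄 (`exists_mem_neil_norm_sub_le`).

For the invertible case, take the ψ so obtained. Invertibility of T_φ at α = (1, 0) makes T_ψ
invertible there, and the solution of ψ g = 1 is bounded because |ψ| ≥ 1 - ‖φ - ψ‖
(`mem_neilInvertible_of_isUnit_toeplitz`). -/

theorem ext_coeff {f g : LpT 2} (h : ∀ n, coeff f n = coeff g n) : f = g := by
  apply (fourierBasis (T := 2 * π)).repr.injective
  ext n
  rw [fourierBasis_repr, fourierBasis_repr]
  exact h n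

theorem coeff_toLp {p : ℝ≥0∞} [Fact (1 ≤ p)] (q : C(Torus, ℂ)) (n : ℤ) :
    coeff (ContinuousMap.toLp p arcLength ℂ q) n = fourierCoeff q n :=
  congrFun (fourierCoeff_congr_ae (ContinuousMap.coeFn_toLp arcLength q)) n

theorem coeff_eq_inner (f : LpT 2) (n : ℤ) : coeff f n = inner ℂ (fourierLp 2 n) f := by
  have h := fourierBasis_repr (T := 2 * π) f n
  rw [HilbertBasis.repr_apply_apply, coe_fourierBasis] at h
  exact h.symm

theorem coeff_mulOp_fourier (ψ : LpT ∞) (k n : ℤ) :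
    coeff (mulOp ψ (fourierLp 2 k)) n = coeff ψ (n - k) := by
  unfold coeff fourierCoeff
  refine integral_congr_ae ?_
  filter_upwards [mulOp_ae ψ (fourierLp 2 k), coeFn_fourierLp (T := 2 * π) 2 k] with t h1 h2
  rw [h1, h2, show -(n - k) = -n + k by ring, fourier_add, smul_eq_mul, smul_eq_mul]
  ring

/-- A coefficient of ψ f is a continuous linear functional of f ∈ L², so it may be evaluated term by
term on the Fourier series of f. -/
theorem hasSum_coeff_mulOp (ψ : LpT ∞) (f : LpT 2) (n : ℤ) :
    HasSum (fun k : ℤ => coeff f k * coeff ψ (n - k)) (coeff (mulOp ψ f) n) := by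
  have h := ((coeffL 2 n).comp (mulOp ψ)).hasSum (hasSum_fourier_series_L2 f)
  refine h.congr_fun fun k => ?_
  simp only [ContinuousLinearMap.comp_apply, map_smul, coeffL_apply,
    coeff_mulOp_fourier, smul_eq_mul]
  rfl

theorem mulOp_mem_hardy {ψ : LpT ∞} {f : LpT 2} (hψ : ψ ∈ hardy ∞) (hf : f ∈ hardy 2) :
    mulOp ψ f ∈ hardy 2 := by
  intro n hn
  refine (hasSum_coeff_mulOp ψ f n).unique ?_
  convert hasSum_zero using 2 with k
  rcases lt_or_ge k 0 with hk | hk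
  · rw [hf k hk, zero_mul]
  · rw [hψ (n - k) (by omega), mul_zero]

theorem coeff_mulOp_of_hardy {ψ : LpT ∞} {f : LpT 2} (hψ : ψ ∈ hardy ∞) (hf : f ∈ hardy 2)
    (n : ℕ) :
    coeff (mulOp ψ f) n = ∑ k ∈ Finset.range (n + 1), coeff f k * coeff ψ (n - k : ℕ) := by
  refine (hasSum_coeff_mulOp ψ f n).unique ?_
  have h : ∀ k ∉ (Finset.range (n + 1)).map (Nat.castEmbedding (R := ℤ)),
      coeff f k * coeff ψ (n - k) = 0 := by
    intro k hk
    rcases lt_or_ge k 0 with h0 | h0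
    · rw [hf k h0, zero_mul]
    · rw [hψ _ _, mul_zero]
      by_contra h1
      apply hk
      simp only [Finset.mem_map, Finset.mem_range, Nat.castEmbedding_apply]
      exact ⟨k.toNat, by omega, by omega⟩
  have h' := hasSum_sum_of_ne_finset_zero (L := SummationFilter.unconditional ℤ) h
  convert h' using 1
  rw [Finset.sum_map]
  refine Finset.sum_congr rfl fun k hk => ?_
  rw [Finset.mem_range] at hk
  rw [Nat.castEmbedding_apply, Nat.cast_sub (by omega)]

theorem coeff_mulOp_zero {ψ : LpT ∞} {f : LpT 2} (hψ : ψ ∈ hardy ∞) (hf : f ∈ hardy 2) :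
    coeff (mulOp ψ f) 0 = coeff f 0 * coeff ψ 0 := by
  simpa using coeff_mulOp_of_hardy hψ hf 0

theorem coeff_mulOp_one {ψ : LpT ∞} {f : LpT 2} (hψ : ψ ∈ hardy ∞) (hf : f ∈ hardy 2) :
    coeff (mulOp ψ f) 1 = coeff f 0 * coeff ψ 1 + coeff f 1 * coeff ψ 0 := by
  simpa [Finset.sum_range_succ] using coeff_mulOp_of_hardy hψ hf 1

theorem mem_neil {ψ : LpT ∞} : ψ ∈ neil ↔ ψ ∈ hardy ∞ ∧ coeff ψ 1 = 0 := by
  rw [← deriv_discFun_zero]; rfl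

theorem mem_hardyAt {α : ℂ × ℂ} {f : LpT 2} :
    f ∈ hardyAt α ↔ f ∈ hardy 2 ∧ coeff f 0 * α.2 = coeff f 1 * α.1 := by
  rw [← deriv_discFun_zero, ← discFun_zero]; rfl

/-- Since ψ'(0) = 0, multiplication by ψ scales the pair (f(0), f'(0)) by ψ(0), and the constraint
defining H²_α is homogeneous in that pair. -/
theorem mulOp_mem_hardyAt {α : ℂ × ℂ} {ψ : LpT ∞} {f : LpT 2} (hψ : ψ ∈ neil)
    (hf : f ∈ hardyAt α) : mulOp ψ f ∈ hardyAt α := by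
  rw [mem_neil] at hψ
  rw [mem_hardyAt] at hf ⊢
  refine ⟨mulOp_mem_hardy hψ.1 hf.1, ?_⟩
  rw [coeff_mulOp_zero hψ.1 hf.1, coeff_mulOp_one hψ.1 hf.1, hψ.2]
  linear_combination coeff ψ 0 * hf.2

theorem summable_norm_discFun {p : ℝ≥0∞} [Fact (1 ≤ p)] (f : LpT p) {z : ℂ} (hz : z ∈ disc) :
    Summable fun n : ℕ => ‖coeff f n * z ^ n‖ := by
  have hz' : ‖z‖ < 1 := by simpa using hz
  refine Summable.of_nonneg_of_le (fun n => norm_nonneg _) (fun n => ?_)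
    ((summable_geometric_of_lt_one (norm_nonneg z) hz').mul_left ‖f‖)
  rw [norm_mul, norm_pow]
  exact mul_le_mul_of_nonneg_right (norm_coeff_le f n) (by positivity)

theorem discFun_mulOp {ψ : LpT ∞} {f : LpT 2} (hψ : ψ ∈ hardy ∞) (hf : f ∈ hardy 2)
    {z : ℂ} (hz : z ∈ disc) : discFun (mulOp ψ f) z = discFun ψ z * discFun f z := by
  rw [mul_comm (discFun ψ z)]
  unfold discFun
  rw [tsum_mul_tsum_eq_tsum_sum_range_of_summable_norm (summable_norm_discFun f hz)
    (summable_norm_discFun ψ hz)]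
  refine tsum_congr fun n => ?_
  rw [coeff_mulOp_of_hardy hψ hf, Finset.sum_mul]
  refine Finset.sum_congr rfl fun k hk => ?_
  rw [Finset.mem_range] at hk
  have : z ^ n = z ^ k * z ^ (n - k) := by rw [← pow_add]; congr 1; omega
  rw [this]; ring

theorem eq_of_discFun_eq {f g : LpT 2} (hf : f ∈ hardy 2) (hg : g ∈ hardy 2)
    (h : ∀ z ∈ disc, discFun f z = discFun g z) : f = g := by
  have h1 := (discFun_hasFPowerSeriesOnBall f).hasFPowerSeriesAt
  have h2 := (discFun_hasFPowerSeriesOnBall g).hasFPowerSeriesAt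
  have h3 : discFun f =ᶠ[nhds 0] discFun g :=
    Filter.eventually_of_mem (Metric.ball_mem_nhds 0 one_pos) h
  have h4 := (h1.congr h3).eq_formalMultilinearSeries h2
  refine ext_coeff fun n => ?_
  rcases lt_or_ge n 0 with hn | hn
  · rw [hf n hn, hg n hn]
  · lift n to ℕ using hn
    have := congrArg (fun p => p.coeff n) h4
    simpa using this

theorem norm_mulOp_le (φ : LpT ∞) : ‖mulOp φ‖ ≤ ‖φ‖ := by
  refine ContinuousLinearMap.opNorm_le_bound _ (norm_nonneg _) fun f => ?_
  refine ((ContinuousLinearMap.mul ℂ ℂ).norm_holder_apply_apply_le (r := 2) φ f).trans ?_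
  simp

theorem mulOp_sub (φ ψ : LpT ∞) : mulOp (φ - ψ) = mulOp φ - mulOp ψ :=
  map_sub _ _ _

theorem norm_mulOp_apply {φ : LpT ∞} (hφ : ∀ᵐ t ∂arcLength, ‖φ t‖ = 1) (f : LpT 2) :
    ‖mulOp φ f‖ = ‖f‖ := by
  rw [Lp.norm_def, Lp.norm_def]
  refine congrArg ENNReal.toReal (eLpNorm_congr_norm_ae ?_)
  filter_upwards [hφ, mulOp_ae φ f] with t h1 h2
  rw [h2, norm_mul, h1, one_mul]

theorem adjoint_mulOp_mulOp {φ : LpT ∞} (hφ : ∀ᵐ t ∂arcLength, ‖φ t‖ = 1) :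
    (ContinuousLinearMap.adjoint (mulOp φ)).comp (mulOp φ) = ContinuousLinearMap.id ℂ _ :=
  (ContinuousLinearMap.norm_map_iff_adjoint_comp_self _).1 (norm_mulOp_apply hφ)

/-- The constant function `1` in `L²`. -/
def oneT : LpT 2 := fourierLp 2 0

theorem oneT_ae : (oneT : Torus → ℂ) =ᵐ[arcLength] fun _ => 1 := by
  filter_upwards [coeFn_fourierLp (T := 2 * π) 2 0] with t ht
  rw [oneT, ht, fourier_zero]

theorem coeff_fourierLp (k n : ℤ) :
    coeff (fourierLp 2 k : LpT 2) n = if n = k then 1 else 0 := by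
  rw [coeff_eq_inner]
  exact orthonormal_iff_ite.mp (orthonormal_fourier (T := 2 * π)) n k

theorem fourierLp_mem_hardy {k : ℤ} (hk : 0 ≤ k) : (fourierLp 2 k : LpT 2) ∈ hardy 2 := by
  intro n hn
  rw [coeff_fourierLp, if_neg (by omega)]

theorem discFun_oneT (z : ℂ) : discFun oneT z = 1 := by
  unfold discFun oneT
  rw [tsum_eq_single 0 (fun n hn => by
    rw [coeff_fourierLp, if_neg (by exact_mod_cast hn), zero_mul])]
  simp [coeff_fourierLp]

theorem mulOp_oneT_ae (ψ : LpT ∞) : (mulOp ψ oneT : Torus → ℂ) =ᵐ[arcLength] ψ := by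
  filter_upwards [mulOp_ae ψ oneT, oneT_ae] with t h1 h2
  rw [h1, h2, mul_one]

theorem coeff_mulOp_oneT (ψ : LpT ∞) (n : ℤ) : coeff (mulOp ψ oneT) n = coeff ψ n :=
  congrFun (fourierCoeff_congr_ae (mulOp_oneT_ae ψ)) n

theorem mulOp_oneT_mem_hardy {ψ : LpT ∞} : mulOp ψ oneT ∈ hardy 2 ↔ ψ ∈ hardy ∞ := by
  exact forall₂_congr fun n _ => by rw [coeff_mulOp_oneT]

theorem discFun_mulOp_oneT (ψ : LpT ∞) : discFun (mulOp ψ oneT) = discFun ψ := by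
  unfold discFun
  simp only [coeff_mulOp_oneT]

/-! ### Toeplitz operators with symbol close to the Neil algebra -/

theorem toeplitz_apply_of_mem_neil {α : ℂ × ℂ} {ψ : LpT ∞} (hψ : ψ ∈ neil) (f : hardyAt α) :
    (toeplitz α ψ f : LpT 2) = mulOp ψ f := by
  have h : mulOp ψ f = (hardyAt α).subtypeL ⟨mulOp ψ f, mulOp_mem_hardyAt hψ f.2⟩ := rfl
  unfold toeplitz
  rw [ContinuousLinearMap.comp_apply, ContinuousLinearMap.comp_apply, Submodule.subtypeL_apply, h,
    Submodule.adjoint_subtypeL, Submodule.subtypeL_apply]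
  exact congrArg Subtype.val (Submodule.orthogonalProjectionOnto_mem_subspace_eq_self _)

/-- The projection between M_φ^* and M_ψ disappears because M_ψ already maps H²_α into itself. -/
theorem adjoint_toeplitz_mul_toeplitz (α : ℂ × ℂ) (φ : LpT ∞) {ψ : LpT ∞} (hψ : ψ ∈ neil) :
    ContinuousLinearMap.adjoint (toeplitz α φ) * toeplitz α ψ =
      (ContinuousLinearMap.adjoint (hardyAt α).subtypeL).comp
        (((ContinuousLinearMap.adjoint (mulOp φ)).comp (mulOp ψ)).comp (hardyAt α).subtypeL) := by
  ext1 f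
  refine ext_inner_left ℂ fun g => ?_
  rw [ContinuousLinearMap.mul_def, ContinuousLinearMap.comp_apply, ContinuousLinearMap.adjoint_inner_right,
    ContinuousLinearMap.comp_apply, ContinuousLinearMap.adjoint_inner_right,
    ContinuousLinearMap.comp_apply, ContinuousLinearMap.comp_apply,
    ContinuousLinearMap.adjoint_inner_right]
  have h : mulOp ψ f = (hardyAt α).subtypeL (toeplitz α ψ f) :=
    (toeplitz_apply_of_mem_neil hψ f).symm
  rw [Submodule.subtypeL_apply (hardyAt α) f, h, ← ContinuousLinearMap.adjoint_inner_left (hardyAt α).subtypeL]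
  rfl

theorem isUnit_adjoint_toeplitz_mul_toeplitz {φ : LpT ∞} (hφ : ∀ᵐ t ∂arcLength, ‖φ t‖ = 1)
    (α : ℂ × ℂ) {ψ : LpT ∞} (hψ : ψ ∈ neil) (h : ‖φ - ψ‖ < 1) :
    IsUnit (ContinuousLinearMap.adjoint (toeplitz α φ) * toeplitz α ψ) := by
  have key : ‖(1 : hardyAt α →L[ℂ] hardyAt α) -
      ContinuousLinearMap.adjoint (toeplitz α φ) * toeplitz α ψ‖ < 1 := by
    refine lt_of_le_of_lt (ContinuousLinearMap.opNorm_le_bound _ (norm_nonneg (φ - ψ))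
      fun f => ?_) h
    have h1 : ((1 : hardyAt α →L[ℂ] hardyAt α) -
        ContinuousLinearMap.adjoint (toeplitz α φ) * toeplitz α ψ) f =
        ContinuousLinearMap.adjoint (hardyAt α).subtypeL
          (ContinuousLinearMap.adjoint (mulOp φ) (mulOp (φ - ψ) f)) := by
      have h2 : ContinuousLinearMap.adjoint (mulOp φ) (mulOp φ f) = (f : LpT 2) :=
        congrArg (fun T => T (f : LpT 2)) (adjoint_mulOp_mulOp hφ)
      rw [adjoint_toeplitz_mul_toeplitz α φ hψ, mulOp_sub]
      simp only [sub_apply, map_sub, h2, ContinuousLinearMap.comp_apply,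
        Submodule.subtypeL_apply, one_apply_eq_self]
      congr 1
      rw [Submodule.adjoint_subtypeL]
      exact (Submodule.orthogonalProjectionOnto_mem_subspace_eq_self _).symm
    have h3 : ‖ContinuousLinearMap.adjoint (hardyAt α).subtypeL‖ ≤ 1 := by
      rw [LinearIsometryEquiv.norm_map]
      exact Submodule.norm_subtypeL_le _
    have h4 : ‖ContinuousLinearMap.adjoint (mulOp φ)‖ ≤ 1 := by
      rw [LinearIsometryEquiv.norm_map]
      exact ContinuousLinearMap.opNorm_le_bound _ zero_le_one fun f => by
        rw [norm_mulOp_apply hφ, one_mul]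
    rw [h1]
    calc _ ≤ 1 * (1 * (‖φ - ψ‖ * ‖(f : LpT 2)‖)) :=
          ContinuousLinearMap.le_of_opNorm_le_of_le _ h3
            (ContinuousLinearMap.le_of_opNorm_le_of_le _ h4
              (ContinuousLinearMap.le_of_opNorm_le _ (norm_mulOp_le _) _))
      _ = _ := by rw [one_mul, one_mul]; rfl
  have := isUnit_one_sub_of_norm_lt_one (R := hardyAt α →L[ℂ] hardyAt α) key
  rwa [sub_sub_cancel] at this

theorem exists_leftInverse_toeplitz {φ : LpT ∞} (hφ : ∀ᵐ t ∂arcLength, ‖φ t‖ = 1)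
    (α : ℂ × ℂ) {ψ : LpT ∞} (hψ : ψ ∈ neil) (h : ‖φ - ψ‖ < 1) :
    ∃ S : hardyAt α →L[ℂ] hardyAt α, S * toeplitz α φ = 1 := by
  have h1 := (isUnit_adjoint_toeplitz_mul_toeplitz hφ α hψ h).star
  rw [star_mul, ContinuousLinearMap.star_eq_adjoint (ContinuousLinearMap.adjoint _),
    ContinuousLinearMap.adjoint_adjoint] at h1
  obtain ⟨B, hB⟩ := h1.exists_left_inv
  exact ⟨B * star (toeplitz α ψ), by rw [mul_assoc, hB]⟩

/-- Carries the reciprocal relation from the disc to the circle: ψ η and 1 have the same power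
series, hence agree as elements of H². -/
theorem ae_mul_eq_one_of_discFun {ψ η : LpT ∞} (hψ : ψ ∈ hardy ∞) (hη : η ∈ hardy ∞)
    (h0 : ∀ z ∈ disc, discFun ψ z ≠ 0) (h : ∀ z ∈ disc, discFun η z = 1 / discFun ψ z) :
    ∀ᵐ t ∂arcLength, ψ t * η t = 1 := by
  have h1 : mulOp ψ (mulOp η oneT) = oneT := by
    have hη' := mulOp_oneT_mem_hardy.2 hη
    refine eq_of_discFun_eq (mulOp_mem_hardy hψ hη') (fourierLp_mem_hardy le_rfl) fun z hz => ?_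
    rw [discFun_mulOp hψ hη' hz, discFun_mulOp_oneT, discFun_oneT, h z hz,
      mul_one_div_cancel (h0 z hz)]
  filter_upwards [mulOp_ae ψ (mulOp η oneT), mulOp_oneT_ae η, oneT_ae] with t h2 h3 h4
  rw [← h3, ← h2, h1, h4]

theorem toeplitz_mul_toeplitz_eq_one {α : ℂ × ℂ} {ψ η : LpT ∞} (hψ : ψ ∈ neil) (hη : η ∈ neil)
    (h : ∀ᵐ t ∂arcLength, ψ t * η t = 1) : toeplitz α ψ * toeplitz α η = 1 := by
  ext1 f
  apply Subtype.ext
  rw [ContinuousLinearMap.mul_def, ContinuousLinearMap.comp_apply, toeplitz_apply_of_mem_neil hψ,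
    toeplitz_apply_of_mem_neil hη]
  refine Lp.ext ?_
  filter_upwards [h, mulOp_ae ψ (mulOp η f), mulOp_ae η f] with t h1 h2 h3
  rw [h2, h3, ← mul_assoc, h1, one_mul]
  rfl

theorem isUnit_toeplitz_of_neilInvertible {φ : LpT ∞} (hφ : ∀ᵐ t ∂arcLength, ‖φ t‖ = 1)
    (α : ℂ × ℂ) {ψ : LpT ∞} (hψ : ψ ∈ neilInvertible) (h : ‖φ - ψ‖ < 1) :
    IsUnit (toeplitz α φ) := by
  obtain ⟨hψn, h0, η, hη, hinv⟩ := hψ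
  have hae := ae_mul_eq_one_of_discFun hψn.1 hη.1 h0 hinv
  have h1 : IsUnit (toeplitz α ψ) :=
    ⟨⟨_, _, toeplitz_mul_toeplitz_eq_one hψn hη hae, toeplitz_mul_toeplitz_eq_one hη hψn
      (by filter_upwards [hae] with t ht; rw [mul_comm, ht])⟩, rfl⟩
  have h2 := isUnit_adjoint_toeplitz_mul_toeplitz hφ α hψn h
  rw [h1.mul_right_iff] at h2
  rw [← ContinuousLinearMap.star_eq_adjoint] at h2
  exact isUnit_star.1 h2

theorem ae_norm_le_norm (f : LpT ∞) : ∀ᵐ t ∂arcLength, ‖f t‖ ≤ ‖f‖ := by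
  filter_upwards [ae_le_eLpNormEssSup (f := f) (μ := arcLength)] with t ht
  rw [Lp.norm_def, eLpNorm_exponent_top, ← toReal_enorm]
  exact ENNReal.toReal_mono (by simpa using Lp.eLpNorm_ne_top f) ht

theorem mem_neilInvertible_of_isUnit_toeplitz {φ : LpT ∞} (hφ : ∀ᵐ t ∂arcLength, ‖φ t‖ = 1)
    (hT : IsUnit (toeplitz (1, 0) φ)) {ψ : LpT ∞} (hψ : ψ ∈ neil) (h : ‖φ - ψ‖ < 1) :
    ψ ∈ neilInvertible := by
  have h1 := isUnit_adjoint_toeplitz_mul_toeplitz hφ (1, 0) hψ h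
  rw [← ContinuousLinearMap.star_eq_adjoint, hT.star.mul_left_iff] at h1
  obtain ⟨B, hB⟩ := h1.exists_right_inv
  have hone : oneT ∈ hardyAt (1, 0) := by
    rw [mem_hardyAt]
    exact ⟨fourierLp_mem_hardy le_rfl, by simp [oneT, coeff_fourierLp]⟩
  set g : LpT 2 := (B ⟨oneT, hone⟩).val with hg
  have hgmem := mem_hardyAt.1 (B ⟨oneT, hone⟩).2
  rw [← hg] at hgmem
  -- A right inverse of the Toeplitz operator of ψ, applied to 1, gives the reciprocal of ψ as an
  -- element of H²_(1,0).
  have hψg : mulOp ψ g = oneT := by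
    rw [hg, ← toeplitz_apply_of_mem_neil hψ, ← ContinuousLinearMap.comp_apply, ← ContinuousLinearMap.mul_def, hB]
    rfl
  have hmul : ∀ᵐ t ∂arcLength, ψ t * g t = 1 := by
    filter_upwards [mulOp_ae ψ g, oneT_ae] with t h2 h3
    rw [← h2, hψg, h3]
  have hbound : ∀ᵐ t ∂arcLength, ‖g t‖ ≤ (1 - ‖φ - ψ‖)⁻¹ := by
    filter_upwards [hmul, hφ, Lp.coeFn_sub φ ψ, ae_norm_le_norm (φ - ψ)] with t h2 h3 h4 h5
    rw [h4, Pi.sub_apply] at h5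
    have h6 : 1 - ‖φ - ψ‖ ≤ ‖ψ t‖ := by
      have := norm_sub_norm_le (φ t) (ψ t)
      linarith
    have h7 : ‖ψ t‖ * ‖g t‖ = 1 := by rw [← norm_mul, h2, norm_one]
    rw [eq_inv_of_mul_eq_one_right h7]
    exact inv_anti₀ (by linarith) h6
  let η : LpT ∞ := (memLp_top_of_bound (Lp.aestronglyMeasurable g) _ hbound).toLp g
  have hη : mulOp η oneT = g := by
    refine Lp.ext ((mulOp_oneT_ae η).trans ?_)
    exact MemLp.coeFn_toLp _
  have hηH : η ∈ hardy ∞ := by rw [← mulOp_oneT_mem_hardy, hη]; exact hgmem.1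
  have hprod : ∀ z ∈ disc, discFun ψ z * discFun η z = 1 := fun z hz => by
    rw [← discFun_mulOp_oneT η, hη, ← discFun_mulOp hψ.1 hgmem.1 hz, hψg, discFun_oneT]
  refine ⟨hψ, fun z hz h0 => ?_, η, mem_neil.2 ⟨hηH, ?_⟩, fun z hz => ?_⟩
  · have := hprod z hz
    rw [h0, zero_mul] at this
    exact zero_ne_one this
  · rw [← coeff_mulOp_oneT, hη]
    -- At α = (1, 0) the constraint on g reads g'(0) = 0, which is what places the reciprocal in 𝔄.
    simpa using hgmem.2.symm
  · exact eq_one_div_of_mul_eq_one_right (hprod z hz)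

/-! ### Uniform bound for the Hankel operators on `H²_α` -/

/-- The unit vector `a + b z` that spans `H²_α` modulo `z² H²`. -/
def vecAt (α : ℂ × ℂ) : LpT 2 := α.1 • fourierLp 2 0 + α.2 • fourierLp 2 1

/-- The space `z² H²`. -/
def hardyTwo : Submodule ℂ (LpT 2) := hardyAt (1, 0) ⊓ hardyAt (0, 1)

theorem mem_hardyTwo {f : LpT 2} :
    f ∈ hardyTwo ↔ f ∈ hardy 2 ∧ coeff f 0 = 0 ∧ coeff f 1 = 0 := by
  rw [hardyTwo, Submodule.mem_inf, mem_hardyAt, mem_hardyAt]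
  simp only [mul_zero, mul_one]
  constructor
  · rintro ⟨⟨h1, h2⟩, -, h3⟩
    exact ⟨h1, h3, h2.symm⟩
  · rintro ⟨h1, h2, h3⟩
    exact ⟨⟨h1, h3.symm⟩, h1, h2⟩

instance completeSpace_hardyTwo : CompleteSpace hardyTwo :=
  ((isClosed_hardyAt (1, 0)).inter (isClosed_hardyAt (0, 1))).completeSpace_coe

theorem inner_vecAt (α : ℂ × ℂ) (f : LpT 2) :
    inner ℂ (vecAt α) f =
      (starRingEnd ℂ) α.1 * coeff f 0 + (starRingEnd ℂ) α.2 * coeff f 1 := by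
  rw [vecAt, inner_add_left, inner_smul_left, inner_smul_left, coeff_eq_inner, coeff_eq_inner]

theorem coeff_vecAt (α : ℂ × ℂ) (n : ℤ) :
    coeff (vecAt α) n = α.1 * (if n = 0 then 1 else 0) + α.2 * (if n = 1 then 1 else 0) := by
  rw [vecAt, coeff_add, coeff_smul, coeff_smul, coeff_fourierLp, coeff_fourierLp]

theorem vecAt_mem (α : ℂ × ℂ) : vecAt α ∈ hardyAt α := by
  rw [mem_hardyAt]
  refine ⟨?_, by simp [coeff_vecAt, mul_comm]⟩
  exact add_mem (Submodule.smul_mem _ _ (fourierLp_mem_hardy le_rfl))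
    (Submodule.smul_mem _ _ (fourierLp_mem_hardy zero_le_one))

theorem inner_vecAt_self {α : ℂ × ℂ} (hα : α ∈ sphere) : inner ℂ (vecAt α) (vecAt α) = 1 := by
  rw [inner_vecAt, coeff_vecAt, coeff_vecAt]
  simp only [if_true, one_ne_zero, zero_ne_one, if_false, mul_one, mul_zero, add_zero, zero_add]
  rw [Complex.conj_mul', Complex.conj_mul']
  exact_mod_cast hα

/-- For f ∈ H²_α the vector (f(0), f'(0)) is a multiple of the unit vector (a, b), so removing its
component along a + b z kills both coefficients. -/
theorem sub_inner_smul_vecAt_mem {α : ℂ × ℂ} (hα : α ∈ sphere) {f : LpT 2}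
    (hf : f ∈ hardyAt α) : f - inner ℂ (vecAt α) f • vecAt α ∈ hardyTwo := by
  have hs : (starRingEnd ℂ) α.1 * α.1 + (starRingEnd ℂ) α.2 * α.2 = 1 := by
    rw [Complex.conj_mul', Complex.conj_mul']
    exact_mod_cast hα
  have hv := mem_hardyAt.1 (vecAt_mem α)
  have hf' := mem_hardyAt.1 hf
  rw [mem_hardyTwo]
  refine ⟨sub_mem hf'.1 (Submodule.smul_mem _ _ hv.1), ?_, ?_⟩
  · rw [← coeffL_apply, map_sub, map_smul, coeffL_apply, coeffL_apply, coeff_vecAt, inner_vecAt]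
    simp only [if_true, zero_ne_one, if_false, mul_one, mul_zero, add_zero, smul_eq_mul]
    linear_combination (-coeff f 0) * hs + (starRingEnd ℂ) α.2 * hf'.2
  · rw [← coeffL_apply, map_sub, map_smul, coeffL_apply, coeffL_apply, coeff_vecAt, inner_vecAt]
    simp only [if_true, one_ne_zero, if_false, mul_one, mul_zero, zero_add, smul_eq_mul]
    linear_combination (-coeff f 1) * hs - (starRingEnd ℂ) α.1 * hf'.2

/-- The orthogonal projection onto `H²_α`, in a form that is visibly continuous in `α`. -/
def projAt (α : ℂ × ℂ) : LpT 2 →L[ℂ] LpT 2 :=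
  hardyTwo.starProjection + (innerSL ℂ (vecAt α)).smulRight (vecAt α)

/-- The parameter enters only through a rank-one term. -/
theorem continuous_projAt : Continuous projAt := by
  have h : Continuous vecAt := by unfold vecAt; fun_prop
  unfold projAt
  refine continuous_const.add ?_
  have h2 := ((ContinuousLinearMap.smulRightL ℂ (LpT 2) (LpT 2)).continuous.comp
    ((innerSL ℂ).continuous.comp h)).clm_apply h
  exact h2

theorem hardyTwo_le (α : ℂ × ℂ) : hardyTwo ≤ hardyAt α := fun f hf => by
  rw [mem_hardyTwo] at hf
  rw [mem_hardyAt, hf.2.1, hf.2.2]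
  exact ⟨hf.1, by simp⟩

/-- H²_α is the orthogonal sum of z² H² and the line through a + b z. -/
theorem starProjection_hardyAt {α : ℂ × ℂ} (hα : α ∈ sphere) :
    (hardyAt α).starProjection = projAt α := by
  ext1 x
  have hx : projAt α x = hardyTwo.starProjection x + inner ℂ (vecAt α) x • vecAt α := rfl
  rw [hx]
  have hvk : ∀ k ∈ hardyTwo, inner ℂ (vecAt α) k = 0 := fun k hk => by
    rw [mem_hardyTwo] at hk
    rw [inner_vecAt, hk.2.1, hk.2.2, mul_zero, mul_zero, add_zero]
  have hP : hardyTwo.starProjection x ∈ hardyTwo := Submodule.starProjection_apply_mem _ _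
  apply Submodule.eq_starProjection_of_mem_of_inner_eq_zero
  · exact add_mem (hardyTwo_le α hP) (Submodule.smul_mem _ _ (vecAt_mem α))
  · intro w hw
    have hk := sub_inner_smul_vecAt_mem hα hw
    set k := w - inner ℂ (vecAt α) w • vecAt α
    have hwk : w = k + inner ℂ (vecAt α) w • vecAt α := (sub_add_cancel _ _).symm
    have h1 : inner ℂ (x - hardyTwo.starProjection x) k = 0 :=
      Submodule.starProjection_inner_eq_zero _ _ hk
    have h2 : inner ℂ (hardyTwo.starProjection x) (vecAt α) = 0 := by
      rw [← inner_conj_symm, hvk _ hP, map_zero]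
    rw [hwk, ← sub_sub, inner_add_right, inner_sub_left, h1, inner_smul_left, hvk k hk,
      inner_smul_right, inner_sub_left, inner_sub_left, h2, inner_smul_left,
      inner_vecAt_self hα, inner_conj_symm]
    ring

theorem isCompact_sphere : IsCompact sphere := by
  refine Metric.isCompact_of_isClosed_isBounded ?_ ?_
  · exact isClosed_eq (by fun_prop) continuous_const
  · refine (Metric.isBounded_closedBall (x := (0 : ℂ × ℂ)) (r := 1)).subset fun α hα => ?_
    have hα' : ‖α.1‖ ^ 2 + ‖α.2‖ ^ 2 = 1 := hα
    rw [mem_closedBall_zero_iff, Prod.norm_def]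
    refine max_le ?_ ?_
    · nlinarith [sq_nonneg ‖α.2‖, norm_nonneg α.1]
    · nlinarith [sq_nonneg ‖α.1‖, norm_nonneg α.2]

/-- The Hankel operator `(1 - P_α) M_φ P_α`. -/
def hankel (φ : LpT ∞) (α : ℂ × ℂ) : LpT 2 →L[ℂ] LpT 2 :=
  (ContinuousLinearMap.id ℂ _ - projAt α).comp ((mulOp φ).comp (projAt α))

theorem continuous_hankel (φ : LpT ∞) : Continuous (hankel φ) := by
  have h := continuous_projAt
  unfold hankel
  fun_prop

theorem norm_hankel_lt_one {φ : LpT ∞} (hφ : ∀ᵐ t ∂arcLength, ‖φ t‖ = 1) {α : ℂ × ℂ}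
    (hα : α ∈ sphere) {S : hardyAt α →L[ℂ] hardyAt α} (hS : S * toeplitz α φ = 1) :
    ‖hankel φ α‖ < 1 := by
  -- Lower bound for the Toeplitz operator. The added 1 keeps c positive without knowing S ≠ 0, and
  -- gives c ≤ 1 so that 1 - c² ≥ 0.
  set c : ℝ := (‖S‖ + 1)⁻¹ with hc
  have hc0 : 0 < c := by positivity
  have hc1 : c ≤ 1 := inv_le_one_of_one_le₀ (by linarith [norm_nonneg S])
  have hbound : ∀ y : hardyAt α, c * ‖y‖ ≤ ‖toeplitz α φ y‖ := fun y => by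
    have h1 : S (toeplitz α φ y) = y := congrArg (fun T => T y) hS
    have h2 : ‖y‖ ≤ ‖S‖ * ‖toeplitz α φ y‖ := by
      conv_lhs => rw [← h1]
      exact S.le_opNorm _
    rw [hc, inv_mul_le_iff₀ (by positivity)]
    nlinarith [norm_nonneg (toeplitz α φ y)]
  have hle : ‖hankel φ α‖ ≤ √(1 - c ^ 2) := by
    refine ContinuousLinearMap.opNorm_le_bound _ (Real.sqrt_nonneg _) fun x => ?_
    have hHx : hankel φ α x = mulOp φ ((hardyAt α).starProjection x) -
        (hardyAt α).starProjection (mulOp φ ((hardyAt α).starProjection x)) := by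
      rw [starProjection_hardyAt hα]; rfl
    set y := (hardyAt α).orthogonalProjectionOnto x
    have hy : (hardyAt α).starProjection x = (y : LpT 2) := rfl
    have hT : (hardyAt α).starProjection (mulOp φ y) = (toeplitz α φ y : LpT 2) := by
      unfold toeplitz
      rw [Submodule.adjoint_subtypeL]; rfl
    rw [hy] at hHx
    -- As M_φ is isometric, ‖y‖² is the sum of the squared Toeplitz and Hankel parts, so the Hankel
    -- part is at most (1 - c²) ‖y‖².
    have hpyth := Submodule.norm_sq_eq_add_norm_sq_starProjection (mulOp φ y) (hardyAt α)
    rw [Submodule.starProjection_orthogonal_val, ← hHx, hT, norm_mulOp_apply hφ] at hpyth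
    have hyx : ‖(y : LpT 2)‖ ≤ ‖x‖ := Submodule.norm_starProjection_apply_le _ _
    have hb := hbound y
    rw [← Real.sqrt_sq (norm_nonneg x), ← Real.sqrt_mul (by nlinarith)]
    apply Real.le_sqrt_of_sq_le
    have e1 : ‖(toeplitz α φ y : LpT 2)‖ = ‖toeplitz α φ y‖ := rfl
    have e2 : ‖(y : LpT 2)‖ = ‖y‖ := rfl
    rw [e1, e2] at hpyth
    rw [e2] at hyx
    have h3 : (c * ‖y‖) ^ 2 ≤ ‖toeplitz α φ y‖ ^ 2 := pow_le_pow_left₀ (by positivity) hb 2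
    have h4 : ‖y‖ ^ 2 ≤ ‖x‖ ^ 2 := pow_le_pow_left₀ (norm_nonneg _) hyx 2
    nlinarith [mul_le_mul_of_nonneg_left h4 (show 0 ≤ 1 - c ^ 2 by nlinarith)]
  refine hle.trans_lt ?_
  rw [Real.sqrt_lt' one_pos]
  nlinarith [sq_pos_of_pos hc0]

/-- If all the Toeplitz operators with unimodular symbol `φ` are left invertible, the Hankel
forms are uniformly strictly contractive. -/
theorem exists_hankel_bound {φ : LpT ∞} (hφ : ∀ᵐ t ∂arcLength, ‖φ t‖ = 1)
    (h : ∀ α ∈ sphere, ∃ S : hardyAt α →L[ℂ] hardyAt α, S * toeplitz α φ = 1) :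
    ∃ r : ℝ, 0 ≤ r ∧ r < 1 ∧ ∀ α ∈ sphere, ∀ f ∈ hardyAt α, ∀ k ∈ (hardyAt α)ᗮ,
      ‖inner ℂ k (mulOp φ f)‖ ≤ r * ‖f‖ * ‖k‖ := by
  have hne : sphere.Nonempty := ⟨(1, 0), by simp [sphere]⟩
  obtain ⟨α₀, hα₀, hmax⟩ := isCompact_sphere.exists_isMaxOn hne
    (continuous_hankel φ).norm.continuousOn
  obtain ⟨S, hS⟩ := h α₀ hα₀
  refine ⟨‖hankel φ α₀‖, norm_nonneg _, norm_hankel_lt_one hφ hα₀ hS, fun α hα f hf k hk => ?_⟩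
  have hHf : hankel φ α f = mulOp φ f - (hardyAt α).starProjection (mulOp φ f) := by
    have : projAt α f = f := by
      rw [← starProjection_hardyAt hα]
      exact Submodule.starProjection_eq_self_iff.2 hf
    change mulOp φ (projAt α f) - projAt α (mulOp φ (projAt α f)) = _
    rw [this, starProjection_hardyAt hα]
  have h1 : inner ℂ k (mulOp φ f) = inner ℂ k (hankel φ α f) := by
    rw [hHf, inner_sub_right,
      Submodule.inner_left_of_mem_orthogonal (Submodule.starProjection_apply_mem _ _) hk, sub_zero]
  rw [h1]
  calc _ ≤ ‖k‖ * ‖hankel φ α f‖ := norm_inner_le_norm _ _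
    _ ≤ ‖k‖ * (‖hankel φ α₀‖ * ‖f‖) := by
      gcongr
      exact ContinuousLinearMap.le_of_opNorm_le _ (hmax hα) f
    _ = _ := by ring

/-! ### Continuous functions with an analytic extension, and outer functions -/

/-- A continuous function on the circle as an element of `L^p`. -/
abbrev toLpT (p : ℝ≥0∞) [Fact (1 ≤ p)] : C(Torus, ℂ) →L[ℂ] LpT p :=
  ContinuousMap.toLp p arcLength ℂ

theorem toLpT_ae (p : ℝ≥0∞) [Fact (1 ≤ p)] (q : C(Torus, ℂ)) :
    (toLpT p q : Torus → ℂ) =ᵐ[arcLength] q := ContinuousMap.coeFn_toLp arcLength q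

theorem mulOp_toLpT (p q : C(Torus, ℂ)) : mulOp (toLpT ∞ p) (toLpT 2 q) = toLpT 2 (p * q) := by
  refine Lp.ext ?_
  filter_upwards [mulOp_ae (toLpT ∞ p) (toLpT 2 q), toLpT_ae ∞ p, toLpT_ae 2 q,
    toLpT_ae 2 (p * q)] with t h1 h2 h3 h4
  rw [h1, h2, h3, h4, ContinuousMap.mul_apply]

theorem toLpT_mem_hardy {p : ℝ≥0∞} [Fact (1 ≤ p)] {q : C(Torus, ℂ)} :
    toLpT p q ∈ hardy p ↔ ∀ n < 0, fourierCoeff q n = 0 :=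
  forall₂_congr fun n _ => by rw [coeff_toLp]

theorem toLpT_fourier (k : ℤ) : toLpT 2 (fourier k) = fourierLp 2 k := rfl

/-- The algebra of continuous functions on the circle without negative frequencies. -/
def discAlgebra : Subalgebra ℂ C(Torus, ℂ) where
  carrier := {q | ∀ n < 0, fourierCoeff q n = 0}
  mul_mem' := fun {p q} hp hq => by
    have := mulOp_mem_hardy (toLpT_mem_hardy.2 hp) (toLpT_mem_hardy.2 hq)
    rw [mulOp_toLpT] at this
    exact toLpT_mem_hardy.1 this
  add_mem' := fun {p q} hp hq => by
    have := add_mem (toLpT_mem_hardy (p := 2).2 hp) (toLpT_mem_hardy.2 hq)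
    rw [← map_add] at this
    exact toLpT_mem_hardy.1 this
  algebraMap_mem' := fun c => by
    have := Submodule.smul_mem _ c (fourierLp_mem_hardy le_rfl)
    rw [← toLpT_fourier, ← map_smul] at this
    have h : c • (fourier 0 : C(Torus, ℂ)) = algebraMap ℂ _ c := by
      ext t; simp
    rw [h] at this
    exact toLpT_mem_hardy.1 this

theorem mem_discAlgebra {q : C(Torus, ℂ)} :
    q ∈ discAlgebra ↔ ∀ n < 0, fourierCoeff q n = 0 := Iff.rfl

theorem fourier_mem_discAlgebra {n : ℤ} (hn : 0 ≤ n) :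
    (fourier n : C(Torus, ℂ)) ∈ discAlgebra :=
  toLpT_mem_hardy.1 (fourierLp_mem_hardy hn)

theorem isClosed_discAlgebra : IsClosed (discAlgebra : Set C(Torus, ℂ)) := by
  have h : (discAlgebra : Set C(Torus, ℂ)) =
      ⋂ n : ℤ, ⋂ _ : n < 0, {q | coeffL 2 n (toLpT 2 q) = 0} := by
    ext q
    simp only [Set.mem_iInter, SetLike.mem_coe, mem_discAlgebra, coeffL_apply, coeff_toLp]
    rfl
  rw [h]
  exact isClosed_iInter fun n => isClosed_iInter fun _ =>
    isClosed_eq ((coeffL 2 n).continuous.comp (toLpT 2).continuous) continuous_const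

/-- The exponential series converges in a closed subalgebra. This supplies zero-free functions whose
inverses are again analytic. -/
theorem exp_mem_discAlgebra {P : C(Torus, ℂ)} (hP : P ∈ discAlgebra) :
    NormedSpace.exp P ∈ discAlgebra :=
  isClosed_discAlgebra.mem_of_tendsto (NormedSpace.exp_series_hasSum_exp' (𝕂 := ℂ) P)
    (Filter.Eventually.of_forall fun _ => sum_mem fun n _ =>
      Subalgebra.smul_mem _ (pow_mem hP n) _)

theorem exp_apply (P : C(Torus, ℂ)) (t : Torus) :
    NormedSpace.exp P t = Complex.exp (P t) := by
  have h := NormedSpace.map_exp (ContinuousMap.evalAlgHom ℂ ℂ t)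
    (continuous_eval_const t) P
  rw [Complex.exp_eq_exp_ℂ]
  exact h

theorem fourierCoeff_mul_zero {p q : C(Torus, ℂ)} (hp : p ∈ discAlgebra) (hq : q ∈ discAlgebra) :
    fourierCoeff (p * q : C(Torus, ℂ)) 0 = fourierCoeff q 0 * fourierCoeff p 0 := by
  have := coeff_mulOp_zero (toLpT_mem_hardy.2 hp) (toLpT_mem_hardy.2 hq)
  rwa [mulOp_toLpT, coeff_toLp, coeff_toLp, coeff_toLp] at this

theorem fourierCoeff_mul_one {p q : C(Torus, ℂ)} (hp : p ∈ discAlgebra) (hq : q ∈ discAlgebra) :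
    fourierCoeff (p * q : C(Torus, ℂ)) 1 =
      fourierCoeff q 0 * fourierCoeff p 1 + fourierCoeff q 1 * fourierCoeff p 0 := by
  have := coeff_mulOp_one (toLpT_mem_hardy.2 hp) (toLpT_mem_hardy.2 hq)
  rwa [mulOp_toLpT, coeff_toLp, coeff_toLp, coeff_toLp, coeff_toLp, coeff_toLp] at this

theorem exists_eq_add_star_of_mem_span {s : C(Torus, ℂ)}
    (hs : s ∈ Submodule.span ℂ (Set.range (fourier (T := 2 * π)))) :
    ∃ P ∈ discAlgebra, ∃ Q ∈ discAlgebra, s = P + star Q := by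
  induction hs using Submodule.span_induction with
  | mem x hx =>
    obtain ⟨n, rfl⟩ := hx
    rcases le_or_gt 0 n with hn | hn
    · exact ⟨_, fourier_mem_discAlgebra hn, 0, zero_mem _, by simp⟩
    · refine ⟨0, zero_mem _, _, fourier_mem_discAlgebra (n := -n) (by omega), ?_⟩
      ext t
      simp
  | zero => exact ⟨0, zero_mem _, 0, zero_mem _, by simp⟩
  | add x y _ _ hx hy =>
    obtain ⟨P, hP, Q, hQ, rfl⟩ := hx
    obtain ⟨P', hP', Q', hQ', rfl⟩ := hy
    exact ⟨P + P', add_mem hP hP', Q + Q', add_mem hQ hQ', by rw [star_add]; abel⟩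
  | smul c x _ hx =>
    obtain ⟨P, hP, Q, hQ, rfl⟩ := hx
    exact ⟨c • P, Subalgebra.smul_mem _ hP c, star c • Q, Subalgebra.smul_mem _ hQ _, by
      rw [star_smul, star_star, smul_add]⟩

/-- Approximate g by a trigonometric polynomial P + Q̄ with P, Q analytic; P + Q is analytic and has
the same real part. -/
theorem exists_re_near (g : C(Torus, ℝ)) {ε : ℝ} (hε : 0 < ε) :
    ∃ P ∈ discAlgebra, ∀ t, |(P t).re - g t| < ε := by
  let G : C(Torus, ℂ) := ⟨fun t => (g t : ℂ), by fun_prop⟩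
  have hG : G ∈ (Submodule.span ℂ (Set.range (fourier (T := 2 * π)))).topologicalClosure := by
    rw [span_fourier_closure_eq_top]; trivial
  obtain ⟨s, hs, hsG⟩ := Metric.mem_closure_iff.1 hG ε hε
  obtain ⟨P, hP, Q, hQ, rfl⟩ := exists_eq_add_star_of_mem_span hs
  refine ⟨P + Q, add_mem hP hQ, fun t => ?_⟩
  have h1 : ‖(G - (P + star Q)) t‖ < ε :=
    (ContinuousMap.norm_coe_le_norm _ t).trans_lt (by rwa [← dist_eq_norm])
  have h2 := (Complex.abs_re_le_norm _).trans_lt h1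
  rw [abs_sub_comm]
  simpa [G] using h2

theorem inner_toLpT (f g : C(Torus, ℂ)) :
    inner ℂ (toLpT 2 f) (toLpT 2 g) = ∫ t, g t * (starRingEnd ℂ) (f t) ∂arcLength :=
  ContinuousMap.inner_toLp (𝕜 := ℂ) arcLength f g

theorem norm_sq_toLpT (f : C(Torus, ℂ)) : ‖toLpT 2 f‖ ^ 2 = ∫ t, ‖f t‖ ^ 2 ∂arcLength := by
  have h := inner_toLpT f f
  rw [inner_self_eq_norm_sq_to_K] at h
  simp only [Complex.mul_conj'] at h
  have h2 : ∫ t, (‖f t‖ : ℂ) ^ 2 ∂arcLength = ((∫ t, ‖f t‖ ^ 2 ∂arcLength : ℝ) : ℂ) := by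
    rw [← integral_complex_ofReal]; simp
  rw [h2] at h
  exact Complex.ofReal_injective (by rw [Complex.ofReal_pow]; exact h)

theorem integrable_of_continuous {f : Torus → ℝ} (hf : Continuous f) : Integrable f arcLength :=
  hf.integrable_of_hasCompactSupport (HasCompactSupport.of_compactSpace f)

/-- Pairing with z c̄ reads off the first coefficient of c u; this gives both the orthogonality to
H²_α and the integral against φ. -/
theorem inner_star_toLpT (c : C(Torus, ℂ)) (u : LpT 2) :
    inner ℂ (toLpT 2 (fourier 1 * star c)) u = coeff (mulOp (toLpT ∞ c) u) 1 := by
  rw [L2.inner_def]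
  unfold coeff fourierCoeff
  refine integral_congr_ae ?_
  filter_upwards [toLpT_ae 2 (fourier 1 * star c), mulOp_ae (toLpT ∞ c) u, toLpT_ae ∞ c]
    with t h1 h2 h3
  rw [h1, h2, h3, fourier_neg]
  simp [mul_comm, mul_left_comm]

/-- The Hankel bound controls the pairing of `φ` with `z̄ h`, through a factorization
`h = q (h / q)` with `|q|²` close to `|h|`. -/
theorem norm_integral_le_of_hankel_bound_aux {φ : LpT ∞} {r : ℝ} (hr : 0 ≤ r)
    (H : ∀ α ∈ sphere, ∀ f ∈ hardyAt α, ∀ k ∈ (hardyAt α)ᗮ,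
      ‖inner ℂ k (mulOp φ f)‖ ≤ r * ‖f‖ * ‖k‖)
    {h : C(Torus, ℂ)} (hh : h ∈ discAlgebra) (h1 : fourierCoeff h 1 = 0) {ε : ℝ} (hε : 0 < ε) :
    ‖∫ t, φ t * (fourier (-1) t * h t) ∂arcLength‖ ≤
      r * (Real.exp ε * (∫ t, ‖h t‖ ∂arcLength + ε)) := by
  -- The shift by ε makes the logarithm continuous even where h vanishes. With q = exp(P/2), |q|²
  -- equals |h| + ε up to a factor between exp(-ε) and exp ε.
  obtain ⟨P, hP, hPw⟩ := exists_re_near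
    ⟨fun t => Real.log (‖h t‖ + ε), Continuous.log (by fun_prop) fun t => by positivity⟩ hε
  simp only [ContinuousMap.coe_mk] at hPw
  set q : C(Torus, ℂ) := NormedSpace.exp ((1 / 2 : ℂ) • P) with hq
  set q' : C(Torus, ℂ) := NormedSpace.exp ((-1 / 2 : ℂ) • P) with hq'
  have hqA : q ∈ discAlgebra := exp_mem_discAlgebra (Subalgebra.smul_mem _ hP _)
  have hqA' : q' ∈ discAlgebra := exp_mem_discAlgebra (Subalgebra.smul_mem _ hP _)
  have hqq : q * q' = 1 := by
    ext t
    rw [ContinuousMap.mul_apply, hq, hq', exp_apply, exp_apply, ← Complex.exp_add]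
    simp only [ContinuousMap.smul_apply, smul_eq_mul, ContinuousMap.one_apply]
    ring_nf
    exact Complex.exp_zero
  have hnq : ∀ t, ‖q t‖ ^ 2 = Real.exp (P t).re := fun t => by
    rw [hq, exp_apply, Complex.norm_exp, ← Real.exp_nat_mul]
    simp
  have hnq' : ∀ t, ‖q' t‖ ^ 2 = Real.exp (-(P t).re) := fun t => by
    rw [hq', exp_apply, Complex.norm_exp, ← Real.exp_nat_mul]
    congr 1
    simp [Complex.mul_re]
    norm_num
    ring
  set c := h * q' with hc
  have hcA : c ∈ discAlgebra := mul_mem hh hqA'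
  have hcq : c * q = h := by rw [hc, mul_assoc, mul_comm q', hqq, mul_one]
  set q0 := fourierCoeff q 0
  set q1 := fourierCoeff q 1
  -- The zeroth coefficient is multiplicative on the disc algebra and q q' = 1.
  have hq0 : q0 ≠ 0 := by
    intro h0
    have e := fourierCoeff_mul_zero hqA hqA'
    rw [hqq] at e
    change _ = _ * q0 at e
    rw [h0, mul_zero] at e
    have e2 := fourierCoeff_fourier (T := 2 * π) 0
    have e3 : (fourier 0 : C(Torus, ℂ)) = 1 := by ext t; simp
    rw [e3] at e2
    rw [e2] at e
    simp at e
  have hrel : q0 * fourierCoeff c 1 + q1 * fourierCoeff c 0 = 0 := by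
    rw [← h1, ← hcq, fourierCoeff_mul_one hcA hqA]
  set N : ℝ := √(‖q0‖ ^ 2 + ‖q1‖ ^ 2)
  have hN : 0 < N := Real.sqrt_pos.2 (by have := norm_pos_iff.2 hq0; positivity)
  have hN0 : (N : ℂ) ≠ 0 := by exact_mod_cast hN.ne'
  -- The normalized 1-jet of q at 0: the parameter is chosen so that q itself lies in H²_α.
  set α : ℂ × ℂ := (q0 / N, q1 / N)
  have hα : α ∈ sphere := by
    change ‖q0 / N‖ ^ 2 + ‖q1 / N‖ ^ 2 = 1
    rw [norm_div, norm_div, Complex.norm_real, Real.norm_of_nonneg hN.le, div_pow, div_pow,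
      ← add_div, Real.sq_sqrt (by positivity), div_self (by
        have := norm_pos_iff.2 hq0; positivity)]
  have hf : toLpT 2 q ∈ hardyAt α := by
    rw [mem_hardyAt, coeff_toLp, coeff_toLp]
    refine ⟨toLpT_mem_hardy.2 hqA, ?_⟩
    change q0 * (q1 / N) = q1 * (q0 / N)
    ring
  have hk : toLpT 2 (fourier 1 * star c) ∈ (hardyAt α)ᗮ := by
    rw [Submodule.mem_orthogonal']
    intro u hu
    obtain ⟨huH, hu2⟩ := mem_hardyAt.1 hu
    rw [inner_star_toLpT, coeff_mulOp_one (toLpT_mem_hardy.2 hcA) huH, coeff_toLp, coeff_toLp]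
    have hu3 : coeff u 0 * q1 = coeff u 1 * q0 := by
      change coeff u 0 * (q1 / N) = coeff u 1 * (q0 / N) at hu2
      field_simp at hu2
      linear_combination hu2
    -- For u ∈ H²_α the jet of u is proportional to that of q, so (cu)'(0) = 0 follows from (cq)'(0)
    -- = h'(0) = 0.
    apply mul_left_cancel₀ hq0
    linear_combination coeff u 0 * hrel - fourierCoeff c 0 * hu3
  have hpair : inner ℂ (toLpT 2 (fourier 1 * star c)) (mulOp φ (toLpT 2 q)) =
      ∫ t, φ t * (fourier (-1) t * h t) ∂arcLength := by
    rw [inner_star_toLpT]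
    unfold coeff fourierCoeff
    refine integral_congr_ae ?_
    filter_upwards [mulOp_ae (toLpT ∞ c) (mulOp φ (toLpT 2 q)), toLpT_ae ∞ c,
      mulOp_ae φ (toLpT 2 q), toLpT_ae 2 q] with t e1 e2 e3 e4
    rw [e1, e2, e3, e4, ← hcq, ContinuousMap.mul_apply c, smul_eq_mul]
    ring
  have hw : ∀ t, 0 < ‖h t‖ + ε := fun t => by positivity
  set I := ∫ t, ‖h t‖ ∂arcLength + ε with hI
  have hI' : ∫ t, Real.exp ε * (‖h t‖ + ε) ∂arcLength = Real.exp ε * I := by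
    rw [integral_const_mul, integral_add (integrable_of_continuous (by fun_prop))
      (integrable_const _)]
    simp [hI]
  have hfn : ‖toLpT 2 q‖ ^ 2 ≤ Real.exp ε * I := by
    rw [norm_sq_toLpT, ← hI']
    refine integral_mono (integrable_of_continuous (by fun_prop))
      (integrable_of_continuous (by fun_prop)) fun t => ?_
    simp only [hnq]
    rw [← Real.exp_log (hw t), ← Real.exp_add]
    exact Real.exp_le_exp.2 (by linarith [(abs_lt.1 (hPw t)).2])
  have hkn : ‖toLpT 2 (fourier 1 * star c)‖ ^ 2 ≤ Real.exp ε * I := by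
    rw [norm_sq_toLpT, ← hI']
    refine integral_mono (integrable_of_continuous (by fun_prop))
      (integrable_of_continuous (by fun_prop)) fun t => ?_
    have e1 : ‖(fourier 1 * star c : C(Torus, ℂ)) t‖ = ‖h t‖ * ‖q' t‖ := by
      simp [hc, Circle.norm_coe]
    simp only [e1, mul_pow, hnq']
    have e2 : Real.exp (-(P t).re) ≤ Real.exp ε * (‖h t‖ + ε)⁻¹ := by
      rw [← Real.exp_log (inv_pos.2 (hw t)), ← Real.exp_add, Real.log_inv]
      exact Real.exp_le_exp.2 (by linarith [(abs_lt.1 (hPw t)).1])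
    calc ‖h t‖ ^ 2 * Real.exp (-(P t).re)
        ≤ (‖h t‖ + ε) ^ 2 * (Real.exp ε * (‖h t‖ + ε)⁻¹) := by
          gcongr
          linarith
      _ = Real.exp ε * (‖h t‖ + ε) := by
          have := (hw t).ne'
          field_simp
  have hfin := H α hα _ hf _ hk
  rw [hpair, mul_assoc] at hfin
  refine hfin.trans (mul_le_mul_of_nonneg_left ?_ hr)
  -- Both squared norms are at most exp ε · I, hence so is the product of the norms, by the
  -- arithmetic–geometric mean inequality.
  nlinarith [sq_nonneg (‖toLpT 2 q‖ - ‖toLpT 2 (fourier 1 * star c)‖)]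

theorem norm_integral_le_of_hankel_bound {φ : LpT ∞} {r : ℝ} (hr : 0 ≤ r)
    (H : ∀ α ∈ sphere, ∀ f ∈ hardyAt α, ∀ k ∈ (hardyAt α)ᗮ,
      ‖inner ℂ k (mulOp φ f)‖ ≤ r * ‖f‖ * ‖k‖)
    {h : C(Torus, ℂ)} (hh : h ∈ discAlgebra) (h1 : fourierCoeff h 1 = 0) :
    ‖∫ t, φ t * (fourier (-1) t * h t) ∂arcLength‖ ≤ r * ∫ t, ‖h t‖ ∂arcLength := by
  have hlim : Filter.Tendsto (fun ε : ℝ => r * (Real.exp ε * (∫ t, ‖h t‖ ∂arcLength + ε)))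
      (nhdsWithin 0 (Set.Ioi 0)) (nhds (r * (Real.exp 0 * (∫ t, ‖h t‖ ∂arcLength + 0)))) :=
    tendsto_nhdsWithin_of_tendsto_nhds (Continuous.tendsto (by fun_prop) 0)
  rw [Real.exp_zero, one_mul, add_zero] at hlim
  exact ge_of_tendsto hlim (Filter.eventually_of_mem self_mem_nhdsWithin fun ε hε =>
    norm_integral_le_of_hankel_bound_aux hr H hh h1 hε)

/-! ### The distance estimate by duality -/

/-- Pairing of `L^∞` with `L¹`. -/
def pairing (φ : LpT ∞) : LpT 1 →L[ℂ] ℂ :=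
  haveI : ENNReal.HolderConjugate ∞ 1 := ENNReal.HolderConjugate.top_one
  (ContinuousLinearMap.mul ℂ ℂ).lpPairing arcLength ∞ 1 φ

theorem pairing_apply (φ : LpT ∞) (g : LpT 1) : pairing φ g = ∫ t, φ t * g t ∂arcLength :=
  haveI : ENNReal.HolderConjugate ∞ 1 := ENNReal.HolderConjugate.top_one
  (ContinuousLinearMap.mul ℂ ℂ).lpPairing_eq_integral φ g

/-- The inclusion of `L²` into `L¹`. -/
def inclL1 : LpT 2 →L[ℂ] LpT 1 :=
  (ContinuousLinearMap.mul ℂ ℂ).holderL arcLength 2 2 1 oneT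

theorem inclL1_ae (f : LpT 2) : (inclL1 f : Torus → ℂ) =ᵐ[arcLength] f := by
  have h : (inclL1 f : Torus → ℂ) =ᵐ[arcLength] fun t => oneT t * f t := by
    simpa [inclL1] using (ContinuousLinearMap.mul ℂ ℂ).coeFn_holder (r := 1) oneT f
  filter_upwards [h, oneT_ae] with t h1 h2
  rw [h1, h2, one_mul]

theorem inclL1_toLpT (q : C(Torus, ℂ)) : inclL1 (toLpT 2 q) = toLpT 1 q :=
  Lp.ext ((inclL1_ae _).trans ((toLpT_ae 2 q).trans (toLpT_ae 1 q).symm))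

/-- A bounded functional on `L¹(𝕋)` is given by a function in `L^∞(𝕋)` with the same bound. -/
theorem exists_pairing_eq (g : LpT 1 →L[ℂ] ℂ) :
    ∃ χ : LpT ∞, ‖χ‖ ≤ ‖g‖ ∧ ∀ f : LpT 2, pairing χ (inclL1 f) = g (inclL1 f) := by
  -- Riesz representation on L². Testing g on v restricted to A = {|v| > ‖g‖} gives ∫_A |v|² ≤ ‖g‖
  -- ∫_A |v|, which forces A to be null; the conjugate of v is then the required χ.
  set v : LpT 2 := (InnerProductSpace.toDual ℂ (LpT 2)).symm (g.comp inclL1)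
  have hv : ∀ f : LpT 2, inner ℂ v f = g (inclL1 f) := fun f =>
    InnerProductSpace.toDual_symm_apply
  have hmeas : Measurable fun t => ‖v t‖ := (Lp.stronglyMeasurable v).measurable.norm
  have hA : MeasurableSet {t | ‖g‖ < ‖v t‖} := measurableSet_lt measurable_const hmeas
  set A := {t | ‖g‖ < ‖v t‖}
  have hu : MemLp (A.indicator v) 2 arcLength := (Lp.memLp v).indicator hA
  have hu_ae := hu.coeFn_toLp
  set u : LpT 2 := hu.toLp _
  have h2 : inner ℂ v u = ((∫ t, A.indicator (fun t => ‖v t‖ ^ 2) t ∂arcLength : ℝ) : ℂ) := by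
    rw [L2.inner_def, ← integral_complex_ofReal]
    refine integral_congr_ae ?_
    filter_upwards [hu_ae] with t ht
    rw [ht]
    by_cases htA : t ∈ A
    · simp only [Set.indicator_of_mem htA]
      rw [RCLike.inner_apply, Complex.mul_conj', Complex.ofReal_pow]
    · simp only [Set.indicator_of_notMem htA, inner_zero_right, Complex.ofReal_zero]
  have h3 : ‖inclL1 u‖ = ∫ t, A.indicator (fun t => ‖v t‖) t ∂arcLength := by
    rw [L1.norm_eq_integral_norm]
    refine integral_congr_ae ?_
    filter_upwards [inclL1_ae u, hu_ae] with t h4 h5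
    rw [h4, h5, norm_indicator_eq_indicator_norm]
  have hint2 : Integrable (A.indicator fun t => ‖v t‖ ^ 2) arcLength :=
    ((Lp.memLp v).norm.integrable_sq).indicator hA
  have hint1 : Integrable (A.indicator fun t => ‖v t‖) arcLength :=
    (((Lp.memLp v).integrable one_le_two).norm).indicator hA
  have h6 : ∫ t, A.indicator (fun t => ‖v t‖ ^ 2) t ∂arcLength ≤
      ‖g‖ * ∫ t, A.indicator (fun t => ‖v t‖) t ∂arcLength := by
    have h7 := g.le_opNorm (inclL1 u)
    rw [← hv, h2, h3, Complex.norm_real] at h7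
    exact (le_abs_self _).trans h7
  have h8 : ∀ᵐ t ∂arcLength, ‖v t‖ ≤ ‖g‖ := by
    have hpos : 0 ≤ fun t => A.indicator (fun t => ‖v t‖ ^ 2) t -
        ‖g‖ * A.indicator (fun t => ‖v t‖) t := by
      intro t
      by_cases htA : t ∈ A
      · simp only [Set.indicator_of_mem htA, Pi.zero_apply]
        have : ‖g‖ < ‖v t‖ := htA
        nlinarith [norm_nonneg (v t)]
      · simp only [Set.indicator_of_notMem htA, mul_zero, sub_zero, Pi.zero_apply, le_refl]
    have hzero : ∫ t, (A.indicator (fun t => ‖v t‖ ^ 2) t -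
        ‖g‖ * A.indicator (fun t => ‖v t‖) t) ∂arcLength = 0 := by
      refine le_antisymm ?_ (integral_nonneg hpos)
      rw [integral_sub hint2 (hint1.const_mul _), integral_const_mul]
      linarith
    rw [integral_eq_zero_iff_of_nonneg hpos (hint2.sub (hint1.const_mul _))] at hzero
    filter_upwards [hzero] with t ht
    by_contra htA
    have htA' : t ∈ A := not_le.1 htA
    simp only [Set.indicator_of_mem htA', Pi.zero_apply] at ht
    have : ‖g‖ < ‖v t‖ := htA'
    nlinarith [norm_nonneg (v t), norm_nonneg g]
  have hχ : MemLp (fun t => (starRingEnd ℂ) (v t)) ∞ arcLength :=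
    memLp_top_of_bound (Complex.continuous_conj.comp_aestronglyMeasurable
      (Lp.aestronglyMeasurable v)) ‖g‖ (by simpa using h8)
  refine ⟨hχ.toLp _, ?_, fun f => ?_⟩
  · refine (Lp.norm_le_of_ae_bound (norm_nonneg g) (C := ‖g‖) ?_).trans ?_
    · filter_upwards [hχ.coeFn_toLp, h8] with t h9 h10
      rw [h9, RCLike.norm_conj]
      exact h10
    · simp
  · rw [← hv, pairing_apply, L2.inner_def]
    refine integral_congr_ae ?_
    filter_upwards [hχ.coeFn_toLp, inclL1_ae f] with t h9 h10
    rw [h9, h10, RCLike.inner_apply, mul_comm]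

/-- Continuous functions of the form `z̄ h` with `h` in the disc algebra and `h'(0) = 0`. -/
def preannihilator : Submodule ℂ C(Torus, ℂ) where
  carrier := {p | fourier 1 * p ∈ discAlgebra ∧ fourierCoeff (fourier 1 * p : C(Torus, ℂ)) 1 = 0}
  add_mem' := fun {p q} hp hq => by
    refine ⟨by rw [mul_add]; exact add_mem hp.1 hq.1, ?_⟩
    have h1 := hp.2
    have h2 := hq.2
    rw [← coeff_toLp (p := 2)] at h1 h2 ⊢
    rw [mul_add, map_add, coeff_add, h1, h2, add_zero]
  zero_mem' := by
    refine ⟨by rw [mul_zero]; exact zero_mem _, ?_⟩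
    rw [← coeff_toLp (p := 2), mul_zero, map_zero]
    exact (coeffL 2 1).map_zero
  smul_mem' := fun c p hp => by
    refine ⟨by rw [mul_smul_comm]; exact Subalgebra.smul_mem _ hp.1 c, ?_⟩
    have h1 := hp.2
    rw [← coeff_toLp (p := 2)] at h1 ⊢
    rw [mul_smul_comm, map_smul, coeff_smul, h1, mul_zero]

theorem fourier_mem_preannihilator {n : ℤ} (h1 : -1 ≤ n) (h0 : n ≠ 0) :
    (fourier n : C(Torus, ℂ)) ∈ preannihilator := by
  have h : (fourier 1 * fourier n : C(Torus, ℂ)) = fourier (1 + n) := by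
    ext t
    rw [ContinuousMap.mul_apply, fourier_add]
  refine ⟨by rw [h]; exact fourier_mem_discAlgebra (by omega), ?_⟩
  rw [h, ← coeff_toLp (p := 2), toLpT_fourier, coeff_fourierLp, if_neg (by omega)]

theorem pairing_fourier (φ : LpT ∞) (n : ℤ) : pairing φ (toLpT 1 (fourier n)) = coeff φ (-n) := by
  rw [pairing_apply]
  unfold coeff fourierCoeff
  refine integral_congr_ae ?_
  filter_upwards [toLpT_ae 1 (fourier n)] with t ht
  rw [ht, neg_neg, smul_eq_mul, mul_comm]

/-- If the Hankel forms of `φ` on all the spaces `H²_α` are bounded by `r`, then `φ` is within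
`r` of the Neil algebra. -/
theorem exists_mem_neil_norm_sub_le {φ : LpT ∞} {r : ℝ} (hr : 0 ≤ r)
    (H : ∀ α ∈ sphere, ∀ f ∈ hardyAt α, ∀ k ∈ (hardyAt α)ᗮ,
      ‖inner ℂ k (mulOp φ f)‖ ≤ r * ‖f‖ * ‖k‖) :
    ∃ ψ ∈ neil, ‖φ - ψ‖ ≤ r := by
  let W : Submodule ℂ (LpT 1) := preannihilator.map (toLpT 1).toLinearMap
  let Λ : W →L[ℂ] ℂ := (pairing φ).comp W.subtypeL
  have hΛ : ‖Λ‖ ≤ r := by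
    refine ContinuousLinearMap.opNorm_le_bound _ hr ?_
    rintro ⟨_, p, ⟨hp, hp1⟩, rfl⟩
    have h1 := norm_integral_le_of_hankel_bound hr H hp hp1
    have h2 : ∫ t, φ t * (fourier (-1) t * (fourier 1 * p : C(Torus, ℂ)) t) ∂arcLength =
        pairing φ (toLpT 1 p) := by
      rw [pairing_apply]
      refine integral_congr_ae ?_
      filter_upwards [toLpT_ae 1 p] with t ht
      rw [ht, ContinuousMap.mul_apply, ← mul_assoc (fourier (-1) t), ← fourier_add]
      simp
    have h3 : ∫ t, ‖(fourier 1 * p : C(Torus, ℂ)) t‖ ∂arcLength = ‖toLpT 1 p‖ := by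
      rw [L1.norm_eq_integral_norm]
      refine integral_congr_ae ?_
      filter_upwards [toLpT_ae 1 p] with t ht
      rw [ht]
      simp [Circle.norm_coe]
    rw [h2, h3] at h1
    exact h1
  -- Extending the pairing from the subspace of functions z̄ h without increasing its norm gives χ
  -- of norm at most r that pairs with that subspace as φ does.
  obtain ⟨g, hg, hgn⟩ := exists_extension_norm_eq W Λ
  obtain ⟨χ, hχ, hχg⟩ := exists_pairing_eq g
  -- The subspace contains the characters of frequency at least -1 other than 0. The pairing
  -- reverses frequencies, so the coefficients of φ - χ vanish exactly where membership in 𝔄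
  -- demands: at negative n and at 1.
  have hcoeff : ∀ n : ℤ, n ≤ 1 → n ≠ 0 → coeff (φ - χ) n = 0 := fun n hn hn0 => by
    have hmem : toLpT 1 (fourier (-n)) ∈ W :=
      ⟨_, fourier_mem_preannihilator (by omega) (by omega), rfl⟩
    have h1 : g (toLpT 1 (fourier (-n))) = pairing φ (toLpT 1 (fourier (-n))) :=
      hg ⟨_, hmem⟩
    have h2 := hχg (toLpT 2 (fourier (-n)))
    rw [inclL1_toLpT, h1, pairing_fourier, pairing_fourier, neg_neg] at h2
    rw [← coeffL_apply, map_sub, coeffL_apply, coeffL_apply, h2, sub_self]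
  refine ⟨φ - χ, mem_neil.2 ⟨fun n hn => hcoeff n (by omega) (by omega),
    hcoeff 1 le_rfl one_ne_zero⟩, ?_⟩
  rw [sub_sub_cancel]
  exact hχ.trans (hgn.trans_le hΛ)

theorem exists_mem_neil_norm_sub_lt_one {φ : LpT ∞} (hφ : ∀ᵐ t ∂arcLength, ‖φ t‖ = 1)
    (h : ∀ α ∈ sphere, ∃ S : hardyAt α →L[ℂ] hardyAt α, S * toeplitz α φ = 1) :
    ∃ ψ ∈ neil, ‖φ - ψ‖ < 1 := by
  obtain ⟨r, hr0, hr1, H⟩ := exists_hankel_bound hφ h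
  obtain ⟨ψ, hψ, hle⟩ := exists_mem_neil_norm_sub_le hr0 H
  exact ⟨ψ, hψ, hle.trans_lt hr1⟩

end

end NeilAlgebra

/-! ### The two equivalences -/

theorem mainTheorem2 (φ : NeilAlgebra.LpT ∞)
    (hφ : ∀ᵐ t ∂NeilAlgebra.arcLength, ‖φ t‖ = 1) :
    (Metric.infDist φ (NeilAlgebra.neil : Set (NeilAlgebra.LpT ∞)) < 1 ↔
      ∀ α ∈ NeilAlgebra.sphere,
        ∃ S : NeilAlgebra.hardyAt α →L[ℂ] NeilAlgebra.hardyAt α,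
          S.comp (NeilAlgebra.toeplitz α φ) = ContinuousLinearMap.id ℂ _) ∧
    (Metric.infDist φ NeilAlgebra.neilInvertible < 1 ↔
      ∀ α ∈ NeilAlgebra.sphere,
        ∃ S : NeilAlgebra.hardyAt α →L[ℂ] NeilAlgebra.hardyAt α,
          S.comp (NeilAlgebra.toeplitz α φ) = ContinuousLinearMap.id ℂ _ ∧
          (NeilAlgebra.toeplitz α φ).comp S = ContinuousLinearMap.id ℂ _) := by
  constructor
  · rw [Metric.infDist_lt_iff ⟨0, zero_mem _⟩]
    simp only [dist_eq_norm]
    refine ⟨?_, NeilAlgebra.exists_mem_neil_norm_sub_lt_one hφ⟩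
    rintro ⟨ψ, hψ, hlt⟩ α -
    exact NeilAlgebra.exists_leftInverse_toeplitz hφ α hψ hlt
  · rw [Metric.infDist_lt_iff ⟨_, NeilAlgebra.const_one_mem_neilInvertible⟩]
    simp only [dist_eq_norm]
    constructor
    · rintro ⟨ψ, hψ, hlt⟩ α -
      obtain ⟨u, hu⟩ := NeilAlgebra.isUnit_toeplitz_of_neilInvertible hφ α hψ hlt
      exact ⟨↑u⁻¹, by rw [← hu]; exact u.inv_mul, by rw [← hu]; exact u.mul_inv⟩
    · intro h
      obtain ⟨ψ, hψ, hlt⟩ := NeilAlgebra.exists_mem_neil_norm_sub_lt_one hφ fun α hα =>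
        (h α hα).imp fun S hS => hS.1
      obtain ⟨S, hS1, hS2⟩ := h (1, 0) (by simp [NeilAlgebra.sphere])
      exact ⟨ψ, NeilAlgebra.mem_neilInvertible_of_isUnit_toeplitz hφ ⟨⟨_, S, hS2, hS1⟩, rfl⟩
        hψ hlt, hlt⟩
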